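/- Let $n\ge 0$ be an integer and let $\lambda_0,\lambda_1,\lambda_2\in\mathbb{C}$ be such that all the zeros of $$U(z)=\lambda_0+n\lambda_1 z+\frac{n(n-1)}{2}\lambda_2z^2$$ lie in the half plane $|z|\le |z-n/2|$. For a complex polynomial $P$ of degree at most $n$ put $$B[P](z)=\lambda_0P(z)+\lambda_1\Big(\frac{nz}{2}\Big)\frac{P'(z)}{1!}+\lambda_2\Big(\frac{nz}{2}\Big)^2\frac{P''(z)}{2!}.$$ Suppose that $P$ does not vanish in the disk $|z|<k$, where $0<k\le 1$. Then for all $\alpha,\beta\in\mathbb{C}$ with $|\alpha|\le 1$, $|\beta|\le 1$, all real $R>r\ge k$ and all $z\in\mathbb{C}$ with $|z|=1$, $$\Big|B[P\circ\sigma](z)+\Phi_k\,B[P\circ\rho](z)\Big|\le\frac12\Big[\{A+C\}\max_{|w|=k}|P(w)|-\{A-C\}\min_{|w|=k}|P(w)|\Big],$$ where $\sigma(w)=Rw$, $\rho(w)=rw$, $$\Phi_k=\beta\Big\{\Big(\frac{R+k}{k+r}\Big)^n-|\alpha|\Big\}-\alpha,\qquad A=\frac{|B[z^n]|}{k^n}\,\big|R^n+r^n\Phi_k\big|,\qquad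 C=|1+\Phi_k|\,|\lambda_0|,$$ and $B[z^n]$ denotes the value at the point $z$ of $B$ applied to the monomial of degree $n$. -/

import Mathlib

open Polynomial

noncomputable section

/-- The polynomial `U(z) = l₀ + n l₁ z + (n(n-1)/2) l₂ z²` attached to the parameters of an
operator of Rahman's class `𝓑ₙ`. -/
def rahmanU (n : ℕ) (l₀ l₁ l₂ : ℂ) : ℂ[X] :=
  C l₀ + C ((n : ℂ) * l₁) * X + C ((n : ℂ) * ((n : ℂ) - 1) / 2 * l₂) * X ^ 2

/-- The parameters `l₀, l₁, l₂` define an operator of the class `𝓑ₙ`: all the zeros of `U` lie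
in the half plane `|z| ≤ |z - n/2|`. -/
def RahmanAdmissible (n : ℕ) (l₀ l₁ l₂ : ℂ) : Prop :=
  ∀ z : ℂ, (rahmanU n l₀ l₁ l₂).eval z = 0 → ‖z‖ ≤ ‖z - (n : ℂ) / 2‖

/-- The operator `B[P](z) = l₀ P(z) + l₁ (nz/2) P'(z)/1! + l₂ (nz/2)² P''(z)/2!`. -/
def rahmanB (n : ℕ) (l₀ l₁ l₂ : ℂ) (P : ℂ[X]) : ℂ[X] :=
  C l₀ * P + C l₁ * (C ((n : ℂ) / 2) * X) * derivative P
    + C l₂ * (C ((n : ℂ) / 2) * X) ^ 2 * (C (1 / 2 : ℂ) * derivative (derivative P))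

/-- The polynomial `z ↦ P(t z)`, for a real number `t`. -/
def dilate (t : ℝ) (P : ℂ[X]) : ℂ[X] := P.comp (C (t : ℂ) * X)

/-- `Φ_k(R, r, α, β) = β {((R + k)/(k + r))ⁿ - |α|} - α`. -/
def rahmanPhi (n : ℕ) (k R r : ℝ) (α β : ℂ) : ℂ :=
  β * ((((R + k) / (k + r)) ^ n - ‖α‖ : ℝ) : ℂ) - α

/-- `max_{|z| = k} |P(z)|` (attained for `0 ≤ k`, see `isGreatest_maxModulus`). -/
def maxModulus (P : ℂ[X]) (k : ℝ) : ℝ :=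
  sSup ((fun w : ℂ => ‖P.eval w‖) '' Metric.sphere (0 : ℂ) k)

/-- `min_{|z| = k} |P(z)|` (attained for `0 ≤ k`, see `isLeast_minModulus`). -/
def minModulus (P : ℂ[X]) (k : ℝ) : ℝ :=
  sInf ((fun w : ℂ => ‖P.eval w‖) '' Metric.sphere (0 : ℂ) k)

theorem isGreatest_maxModulus (P : ℂ[X]) {k : ℝ} (hk : 0 ≤ k) :
    IsGreatest ((fun w : ℂ => ‖P.eval w‖) '' Metric.sphere (0 : ℂ) k) (maxModulus P k) :=
  ((isCompact_sphere (0 : ℂ) k).image P.continuous.norm).isGreatest_sSup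
    ((NormedSpace.sphere_nonempty.2 hk).image _)

theorem isLeast_minModulus (P : ℂ[X]) {k : ℝ} (hk : 0 ≤ k) :
    IsLeast ((fun w : ℂ => ‖P.eval w‖) '' Metric.sphere (0 : ℂ) k) (minModulus P k) :=
  ((isCompact_sphere (0 : ℂ) k).image P.continuous.norm).isLeast_sInf
    ((NormedSpace.sphere_nonempty.2 hk).image _)

end

/-! Replacing `P` by `dilate k P` and `R`, `r` by `R / k`, `r / k` reduces to `k = 1`. Let `T` be
the functional `rahmanT`. Its main property is monotonicity (`norm_rahmanT_le`): if `F` has exact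
degree `n` and no zeros in `|w| > 1`, and `|P| ≤ |F|` there, then `|T P| ≤ |T F|` for `|z| ≥ 1`. It
rests on two facts about degree `n` polynomials with all zeros in the closed unit disk: `f(Rw) + Φ
f(rw)` is again one (`norm_eval_growth`), and `B` creates no zeros outside the disk
(`eval_rahmanB_ne_zero`).

Let `Q` be the conjugate reciprocal of `P`, and `m ≤ |P| ≤ M` in the disk. If `P` omits the value
`c` there, then `P - c` is dominated outside by its reciprocal `Q - conj c * w ^ n`, and `T`
preserves this. Choosing the argument of `c` well, `|c| ↓ M` bounds `|T P| + |T Q|` and `|c| ↑ m`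
bounds `|T P| - |T Q|`. The sum of the two bounds is the theorem. -/

/-! ### Zeros of `B[G]` -/

theorem exists_eq_C_mul_prod_X_sub_C {n : ℕ} (G : ℂ[X]) (hG : G.natDegree = n) :
    ∃ (a : ℂ) (ζ : Fin n → ℂ), G = C a * ∏ i, (X - C (ζ i)) := by
  have hs := IsAlgClosed.splits G
  obtain ⟨l, hl⟩ : ∃ l : List ℂ, (l : Multiset ℂ) = G.roots := Quot.exists_rep _
  have hc : l.length = n := by
    rw [← hG, hs.natDegree_eq_card_roots, ← hl, Multiset.coe_card]
  subst hc
  refine ⟨G.leadingCoeff, fun i => l[i], ?_⟩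
  conv_lhs => rw [hs.eq_prod_roots]
  rw [← hl, Multiset.map_coe, Multiset.prod_coe, ← Fin.prod_univ_fun_getElem]
  rfl

theorem eval_derivatives_prod_X_sub_C {ι : Type*} (s : Finset ι) (ζ : ι → ℂ) (z : ℂ)
    (h : ∀ i ∈ s, z - ζ i ≠ 0) :
    z * (derivative (∏ i ∈ s, (X - C (ζ i)))).eval z
        = (∏ i ∈ s, (X - C (ζ i))).eval z * ∑ i ∈ s, z / (z - ζ i) ∧
    z ^ 2 * (derivative (derivative (∏ i ∈ s, (X - C (ζ i))))).eval z
        = (∏ i ∈ s, (X - C (ζ i))).eval z *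
          ((∑ i ∈ s, z / (z - ζ i)) ^ 2 - ∑ i ∈ s, (z / (z - ζ i)) ^ 2) := by
  classical
  induction s using Finset.induction_on with
  | empty => simp
  | insert a s ha ih =>
    obtain ⟨h1, h2⟩ := ih fun i hi => h i (Finset.mem_insert_of_mem hi)
    have hz : z - ζ a ≠ 0 := h a (Finset.mem_insert_self a s)
    rw [Finset.prod_insert ha, Finset.sum_insert ha, Finset.sum_insert ha]
    set G := ∏ i ∈ s, (X - C (ζ i))
    set S := ∑ i ∈ s, z / (z - ζ i)
    set S2 := ∑ i ∈ s, (z / (z - ζ i)) ^ 2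
    have hw : z = (z / (z - ζ a)) * (z - ζ a) := by field_simp
    set w := z / (z - ζ a)
    simp only [derivative_mul, derivative_add, derivative_sub, derivative_X, derivative_C,
      eval_add, eval_mul, eval_sub, eval_X, eval_C, sub_zero, one_mul]
    constructor
    · linear_combination (z - ζ a) * h1 + G.eval z * hw
    · linear_combination (z - ζ a) * h2 + 2 * z * h1 + 2 * G.eval z * S * hw

/-- Put `∑ u = p + iq`. Termwise, `p * Re(u ^ 2 * conj (∑ u))` falls short of `(Re u) ^ 2 * (p ^ 2 +
q ^ 2)` by the square of `p * Im u - q * Re u`. This reduces the claim to the real parts, where `p ^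
2 - ∑ (Re u) ^ 2` is the sum of the products over pairs of distinct indices. -/
theorem re_sq_sum_sub_sum_sq {ι : Type*} [Fintype ι] (u : ι → ℂ) (h : ℝ) (hh : 0 ≤ h)
    (hcard : 2 ≤ Fintype.card ι) (hu : ∀ i, h < (u i).re) :
    ((Fintype.card ι : ℝ) - 1) * h * Complex.normSq (∑ i, u i)
      < (((∑ i, u i) ^ 2 - ∑ i, u i ^ 2) * (starRingEnd ℂ) (∑ i, u i)).re := by
  classical
  set p : ℝ := ∑ i, (u i).re with hp
  set q : ℝ := ∑ i, (u i).im with hq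
  have hne : (Finset.univ : Finset ι).Nonempty := by
    rw [← Finset.card_pos, Finset.card_univ]; omega
  have hppos : 0 < p := Finset.sum_pos (fun i _ => hh.trans_lt (hu i)) hne
  have hS : ∑ i, u i = ⟨p, q⟩ := by
    apply Complex.ext <;> simp [hp, hq]
  have hS2 : ∑ i, u i ^ 2
      = ⟨∑ i, ((u i).re ^ 2 - (u i).im ^ 2), ∑ i, 2 * ((u i).re * (u i).im)⟩ := by
    apply Complex.ext
    · simp [sq]
    · simp only [sq, Complex.im_sum, Complex.mul_im]
      exact Finset.sum_congr rfl fun i _ => by ring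
  have hlow : ((Fintype.card ι : ℝ) - 1) * h * p < p ^ 2 - ∑ i, (u i).re ^ 2 := by
    have h1 : p ^ 2 - ∑ i, (u i).re ^ 2 = ∑ i, (u i).re * (p - (u i).re) := by
      simp only [mul_sub, Finset.sum_sub_distrib, ← Finset.sum_mul, ← hp, sq]
    have h2 : ((Fintype.card ι : ℝ) - 1) * h * p
        = ∑ i, (u i).re * (((Fintype.card ι : ℝ) - 1) * h) := by
      rw [← Finset.sum_mul, ← hp]; ring
    rw [h1, h2]
    refine Finset.sum_lt_sum_of_nonempty hne fun i _ => ?_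
    refine mul_lt_mul_of_pos_left ?_ (hh.trans_lt (hu i))
    have h3 : p - (u i).re = ∑ j ∈ Finset.univ.erase i, (u j).re := by
      rw [hp, ← Finset.add_sum_erase _ _ (Finset.mem_univ i)]; ring
    have hc : (Finset.univ.erase i).card = Fintype.card ι - 1 := by
      rw [Finset.card_erase_of_mem (Finset.mem_univ i), Finset.card_univ]
    have h4 : ((Fintype.card ι : ℝ) - 1) * h = ∑ j ∈ Finset.univ.erase i, h := by
      rw [Finset.sum_const, hc, nsmul_eq_mul, Nat.cast_sub (by omega), Nat.cast_one]
    rw [h3, h4]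
    refine Finset.sum_lt_sum_of_nonempty ?_ fun j _ => hu j
    rw [← Finset.card_pos, hc]; omega
  have hup : p * ((∑ i, ((u i).re ^ 2 - (u i).im ^ 2)) * p
        + (∑ i, 2 * ((u i).re * (u i).im)) * q) ≤ (∑ i, (u i).re ^ 2) * (p ^ 2 + q ^ 2) := by
    rw [Finset.sum_mul _ _ p, Finset.sum_mul _ _ q, ← Finset.sum_add_distrib, Finset.mul_sum,
      Finset.sum_mul]
    refine Finset.sum_le_sum fun i _ => ?_
    nlinarith [sq_nonneg ((u i).im * p - (u i).re * q)]
  have hpos : 0 < p ^ 2 + q ^ 2 := by positivity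
  rw [hS, hS2]
  simp only [Complex.normSq_mk, sq, Complex.mul_re, Complex.sub_re, Complex.sub_im, Complex.mul_im,
    Complex.conj_re, Complex.conj_im] at *
  refine lt_of_mul_lt_mul_left (a := p) ?_ hppos.le
  nlinarith [mul_lt_mul_of_pos_right hlow hpos]

theorem RahmanAdmissible.re_le {n : ℕ} {l₀ l₁ l₂ : ℂ} (hB : RahmanAdmissible n l₀ l₁ l₂)
    (hn : 1 ≤ n) {x : ℂ}
    (hx : l₀ + n * l₁ * x + n * (n - 1) / 2 * l₂ * x ^ 2 = 0) : x.re ≤ n / 4 := by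
  have h := hB x (by simpa [rahmanU] using hx)
  have hn' : (1 : ℝ) ≤ n := by exact_mod_cast hn
  have h2 : ‖x‖ ^ 2 ≤ ‖x - (n : ℂ) / 2‖ ^ 2 := by gcongr
  have e : (n : ℂ) / 2 = ((n / 2 : ℝ) : ℂ) := by push_cast; rfl
  rw [e, Complex.sq_norm, Complex.sq_norm, Complex.normSq_apply, Complex.normSq_apply] at h2
  simp only [Complex.sub_re, Complex.sub_im, Complex.ofReal_re, Complex.ofReal_im] at h2
  nlinarith

/-- The expression polarizes `U`: with all `w i` equal to `w` it is `U(n w / 2)`, whose zeros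
satisfy `Re w ≤ 1 / 2`. The argument is a direct proof of the Grace–Walsh coincidence principle for
this case. With `w i = z / (z - ζ i)` the expression is `B[G](z) / G(z)`. -/
theorem RahmanAdmissible.symmetrized_ne_zero {n : ℕ} {l₀ l₁ l₂ : ℂ}
    (hB : RahmanAdmissible n l₀ l₁ l₂) (hn : 1 ≤ n) (w : Fin n → ℂ) (hw : ∀ i, 1 / 2 < (w i).re) :
    l₀ + l₁ * (n / 2) * (∑ i, w i)
      + l₂ * (n ^ 2 / 8) * ((∑ i, w i) ^ 2 - ∑ i, w i ^ 2) ≠ 0 := by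
  intro h0
  have hnR : (1 : ℝ) ≤ n := by exact_mod_cast hn
  have hnC : (n : ℂ) ≠ 0 := by exact_mod_cast (by omega : n ≠ 0)
  have hre : (n : ℝ) / 2 < (∑ i, w i).re := by
    have : NeZero n := ⟨by omega⟩
    have : ∑ _i : Fin n, (1 / 2 : ℝ) < ∑ i, (w i).re :=
      Finset.sum_lt_sum_of_nonempty Finset.univ_nonempty fun i _ => hw i
    rw [Complex.re_sum]
    simpa [div_eq_mul_inv] using this
  -- Here `U` is affine and the quadratic term drops out (for `n = 1` because `S ^ 2 = S2`), so half
  -- the sum is itself a zero of `U`.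
  by_cases hl : (n : ℂ) * (n - 1) * l₂ = 0
  · have hx : l₂ * (n ^ 2 / 8) * ((∑ i, w i) ^ 2 - ∑ i, w i ^ 2) = 0 := by
      rcases mul_eq_zero.1 hl with h | h
      · have : (n : ℂ) = 1 := by
          rcases mul_eq_zero.1 h with h | h
          · exact absurd h hnC
          · exact sub_eq_zero.1 h
        have hn1 : n = 1 := by exact_mod_cast this
        subst hn1
        simp
      · simp [h]
    have := hB.re_le hn (x := (∑ i, w i) / 2)
      (by linear_combination h0 - hx + ((∑ i, w i) / 2) ^ 2 / 2 * hl)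
    have e : ((∑ i, w i) / 2).re = (∑ i, w i).re / 2 := by simp
    rw [e] at this
    linarith
  · have hl2 : l₂ ≠ 0 := fun h => hl (by simp [h])
    have hn1 : (n : ℂ) - 1 ≠ 0 := fun h => hl (by simp [h])
    have hn2 : 2 ≤ n := by
      rcases Nat.lt_or_ge n 2 with h | h
      · exact absurd (by rw [show n = 1 by omega]; simp) hn1
      · exact h
    obtain ⟨x₁, hx₁⟩ : ∃ x : ℂ, l₀ + n * l₁ * x + n * (n - 1) / 2 * l₂ * x ^ 2 = 0 := by
      have hd : (rahmanU n l₀ l₁ l₂).degree ≠ 0 := by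
        have hc : (rahmanU n l₀ l₁ l₂).coeff 2 ≠ 0 := by
          have e : (rahmanU n l₀ l₁ l₂).coeff 2 = n * (n - 1) / 2 * l₂ := by
            simp only [rahmanU, coeff_add, coeff_C_mul, coeff_C, coeff_X, coeff_X_pow]
            norm_num
          rw [e]
          exact mul_ne_zero (div_ne_zero (mul_ne_zero hnC hn1) two_ne_zero) hl2
        intro h
        exact hc (coeff_eq_zero_of_degree_lt (by rw [h]; norm_num))
      obtain ⟨x, hx⟩ := IsAlgClosed.exists_root _ hd
      exact ⟨x, by simpa [rahmanU, IsRoot] using hx⟩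
    set x₂ : ℂ := -2 * l₁ / ((n - 1) * l₂) - x₁ with hx₂
    have hsum : l₁ = -(x₁ + x₂) * ((n - 1) * l₂) / 2 := by
      rw [hx₂]; field_simp; ring
    have hx₂' : l₀ + n * l₁ * x₂ + n * (n - 1) / 2 * l₂ * x₂ ^ 2 = 0 := by
      rw [← hx₁, hsum]; ring
    have hprod : l₀ = n * (n - 1) / 2 * l₂ * (x₁ * x₂) := by
      have := hx₁
      rw [hsum] at this
      linear_combination this
    have r1 := hB.re_le hn hx₁
    have r2 := hB.re_le hn hx₂'
    set a : ℂ := 2 * x₁ / n with ha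
    set b : ℂ := 2 * x₂ / n with hb
    have ex1 : x₁ = n / 2 * a := by rw [ha]; field_simp
    have ex2 : x₂ = n / 2 * b := by rw [hb]; field_simp
    have scale (c : ℂ) : ((n : ℂ) / 2 * c).re = n / 2 * c.re := by
      rw [show (n : ℂ) / 2 = ((n / 2 : ℝ) : ℂ) by push_cast; rfl, Complex.re_ofReal_mul]
    rw [ex1, scale] at r1
    rw [ex2, scale] at r2
    have ra : a.re ≤ 1 / 2 := by nlinarith
    have rb : b.re ≤ 1 / 2 := by nlinarith
    set S := ∑ i, w i with hS
    set S2 := ∑ i, w i ^ 2 with hS2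
    have key : S ^ 2 - S2 - (n - 1) * (a + b) * S + n * (n - 1) * a * b = 0 := by
      have : l₂ * (n ^ 2 / 8) *
          (S ^ 2 - S2 - (n - 1) * (a + b) * S + n * (n - 1) * a * b) = 0 := by
        rw [hprod, hsum, ex1, ex2] at h0
        linear_combination h0
      refine (mul_eq_zero.1 this).resolve_left (mul_ne_zero hl2 ?_)
      exact div_ne_zero (pow_ne_zero 2 hnC) (by norm_num)
    -- Translating by the root `a` turns `key` into `(∑ u) ^ 2 - ∑ u ^ 2 = (n - 1) (b - a) ∑ u`; the
    -- inequality then forces `1 / 2 - Re a < Re b - Re a`, against `rb`.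
    have hineq := re_sq_sum_sub_sum_sq (fun i => w i - a) (1 / 2 - a.re) (by linarith)
      (by simpa using hn2) (fun i => by simpa using hw i)
    have e1 : ∑ i, (w i - a) = S - n * a := by simp [Finset.sum_sub_distrib, hS]
    have e2 : ∑ i, (w i - a) ^ 2 = S2 - 2 * a * S + n * a ^ 2 := by
      simp only [sub_sq, Finset.sum_add_distrib, Finset.sum_sub_distrib, Finset.sum_const,
        Finset.card_univ, Fintype.card_fin, nsmul_eq_mul, ← Finset.sum_mul, ← Finset.mul_sum,
        ← hS, ← hS2]
      ring
    have e3 : (S - n * a) ^ 2 - (S2 - 2 * a * S + n * a ^ 2)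
        = ((n : ℂ) - 1) * (b - a) * (S - n * a) := by linear_combination key
    rw [e1, e2, e3, mul_assoc _ (S - n * a), Complex.mul_conj, Complex.re_mul_ofReal,
      Fintype.card_fin] at hineq
    have e4 : (((n : ℂ) - 1) * (b - a)).re = ((n : ℝ) - 1) * (b.re - a.re) := by
      rw [show (n : ℂ) - 1 = ((n - 1 : ℝ) : ℂ) by push_cast; rfl, Complex.re_ofReal_mul,
        Complex.sub_re]
    rw [e4] at hineq
    have := lt_of_mul_lt_mul_right hineq (Complex.normSq_nonneg _)
    nlinarith

theorem half_lt_re_div_sub {z ζ : ℂ} (h : ‖ζ‖ < ‖z‖) : 1 / 2 < (z / (z - ζ)).re := by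
  have hne : z - ζ ≠ 0 := by
    intro h0
    rw [sub_eq_zero.1 h0] at h
    exact lt_irrefl _ h
  have hpos := Complex.normSq_pos.2 hne
  have h2 : ‖ζ‖ ^ 2 < ‖z‖ ^ 2 := by gcongr
  rw [Complex.div_re, ← add_div, lt_div_iff₀ hpos]
  rw [Complex.sq_norm, Complex.sq_norm] at h2
  simp only [Complex.normSq_apply, Complex.sub_re, Complex.sub_im] at *
  nlinarith

/-- Rahman's operators preserve the property of having all zeros in the closed unit disk. -/
theorem RahmanAdmissible.eval_rahmanB_ne_zero {n : ℕ} {l₀ l₁ l₂ : ℂ}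
    (hB : RahmanAdmissible n l₀ l₁ l₂) (hn : 1 ≤ n) {G : ℂ[X]} (hG : G.natDegree = n)
    {ρ : ℝ} (hzero : ∀ w : ℂ, ρ < ‖w‖ → G.eval w ≠ 0) {z : ℂ} (hz : ρ < ‖z‖) :
    (rahmanB n l₀ l₁ l₂ G).eval z ≠ 0 := by
  obtain ⟨a, ζ, rfl⟩ := exists_eq_C_mul_prod_X_sub_C G hG
  have hroot (i) : ‖ζ i‖ ≤ ρ := by
    by_contra! h
    refine hzero _ h ?_
    rw [eval_mul, eval_prod, Finset.prod_eq_zero (Finset.mem_univ i) (by simp), mul_zero]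
  have hne (i) : z - ζ i ≠ 0 := by
    intro h0
    have := hroot i
    rw [← sub_eq_zero.1 h0] at this
    linarith
  obtain ⟨h1, h2⟩ := eval_derivatives_prod_X_sub_C Finset.univ ζ z fun i _ => hne i
  have hmain := hB.symmetrized_ne_zero hn (fun i => z / (z - ζ i))
    fun i => half_lt_re_div_sub ((hroot i).trans_lt hz)
  intro h0
  refine mul_ne_zero (hzero z hz) hmain ?_
  simp only [rahmanB, derivative_C_mul, eval_add, eval_mul, eval_pow, eval_C, eval_X] at h0 ⊢
  linear_combination h0 - a * l₁ * (n / 2) * h1 - a * l₂ * (n ^ 2 / 8) * h2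

/-! ### The functional `T`: linearity and special values -/

/-- The value at `z` of `B[P ∘ σ] + Φ B[P ∘ ρ]`, where `σ(w) = R w` and `ρ(w) = r w`. -/
noncomputable def rahmanT (n : ℕ) (l₀ l₁ l₂ : ℂ) (R r : ℝ) (Φ z : ℂ) (P : ℂ[X]) : ℂ :=
  (rahmanB n l₀ l₁ l₂ (dilate R P)).eval z + Φ * (rahmanB n l₀ l₁ l₂ (dilate r P)).eval z

theorem eval_dilate (t : ℝ) (P : ℂ[X]) (w : ℂ) : (dilate t P).eval w = P.eval (t * w) := by
  simp [dilate]

theorem coeff_dilate (t : ℝ) (P : ℂ[X]) (j : ℕ) :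
    (dilate t P).coeff j = P.coeff j * (t : ℂ) ^ j := by
  rw [dilate, comp_C_mul_X_coeff]

theorem natDegree_dilate_le (t : ℝ) (P : ℂ[X]) : (dilate t P).natDegree ≤ P.natDegree := by
  refine natDegree_le_iff_coeff_eq_zero.2 fun j hj => ?_
  rw [coeff_dilate, coeff_eq_zero_of_natDegree_lt hj, zero_mul]

theorem rahmanT_eq_eval (n : ℕ) (l₀ l₁ l₂ : ℂ) (R r : ℝ) (Φ z : ℂ) (P : ℂ[X]) :
    rahmanT n l₀ l₁ l₂ R r Φ z P
      = (rahmanB n l₀ l₁ l₂ (dilate R P + C Φ * dilate r P)).eval z := by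
  simp only [rahmanT, rahmanB, derivative_add, derivative_C_mul, eval_add, eval_mul, eval_pow,
    eval_C, eval_X]
  ring

theorem rahmanT_sub (n : ℕ) (l₀ l₁ l₂ : ℂ) (R r : ℝ) (Φ z : ℂ) (P Q : ℂ[X]) :
    rahmanT n l₀ l₁ l₂ R r Φ z (P - Q)
      = rahmanT n l₀ l₁ l₂ R r Φ z P - rahmanT n l₀ l₁ l₂ R r Φ z Q := by
  simp only [rahmanT, rahmanB, dilate, sub_comp, derivative_sub, eval_add, eval_sub, eval_mul,
    eval_pow, eval_C, eval_X]
  ring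

theorem rahmanT_C_mul (n : ℕ) (l₀ l₁ l₂ : ℂ) (R r : ℝ) (Φ z c : ℂ) (P : ℂ[X]) :
    rahmanT n l₀ l₁ l₂ R r Φ z (C c * P) = c * rahmanT n l₀ l₁ l₂ R r Φ z P := by
  simp only [rahmanT, rahmanB, dilate, mul_comp, C_comp, derivative_C_mul, eval_add, eval_mul,
    eval_pow, eval_C, eval_X]
  ring

theorem rahmanT_C (n : ℕ) (l₀ l₁ l₂ : ℂ) (R r : ℝ) (Φ z c : ℂ) :
    rahmanT n l₀ l₁ l₂ R r Φ z (C c) = c * ((1 + Φ) * l₀) := by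
  simp only [rahmanT, rahmanB, dilate, C_comp, derivative_C, derivative_zero, mul_zero, add_zero,
    eval_mul, eval_C]
  ring

theorem rahmanT_X_pow (n : ℕ) (l₀ l₁ l₂ : ℂ) (R r : ℝ) (Φ z : ℂ) (m : ℕ) :
    rahmanT n l₀ l₁ l₂ R r Φ z (X ^ m)
      = (rahmanB n l₀ l₁ l₂ (X ^ m)).eval z * ((R : ℂ) ^ m + (r : ℂ) ^ m * Φ) := by
  have h (t : ℝ) : dilate t (X ^ m) = C ((t : ℂ) ^ m) * X ^ m := by
    rw [dilate, X_pow_comp, mul_pow, C_pow]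
  simp only [rahmanT, rahmanB, h, derivative_C_mul, eval_add, eval_mul, eval_pow, eval_C, eval_X]
  ring

theorem continuous_rahmanT (n : ℕ) (l₀ l₁ l₂ : ℂ) (R r : ℝ) (Φ : ℂ) (P : ℂ[X]) :
    Continuous fun z => rahmanT n l₀ l₁ l₂ R r Φ z P :=
  (Polynomial.continuous _).add (continuous_const.mul (Polynomial.continuous _))

/-! ### Growth along rays and monotonicity of `T` -/

/-- The difference of the squares is `(R - r) * ((R * r - 1) * |w + ζ| ^ 2 + (R + 1) * (r + 1) *
(|w| ^ 2 - |ζ| ^ 2))`. -/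
theorem norm_sub_growth {R r : ℝ} (hr : 1 ≤ r) (hR : r < R) {w ζ : ℂ} (hw : 1 < ‖w‖)
    (hζ : ‖ζ‖ ≤ 1) : (R + 1) * ‖r * w - ζ‖ < (1 + r) * ‖R * w - ζ‖ := by
  refine lt_of_pow_lt_pow_left₀ 2 (by positivity) ?_
  have hs : 1 < ‖w‖ ^ 2 := one_lt_pow₀ hw two_ne_zero
  have ht : ‖ζ‖ ^ 2 ≤ 1 := pow_le_one₀ (norm_nonneg _) hζ
  rw [mul_pow, mul_pow]
  simp only [Complex.sq_norm, Complex.normSq_apply, Complex.sub_re, Complex.sub_im,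
    Complex.re_ofReal_mul, Complex.im_ofReal_mul] at hs ht ⊢
  have h1 : 0 ≤ (R * r - 1) * ((w.re + ζ.re) ^ 2 + (w.im + ζ.im) ^ 2) := by
    apply mul_nonneg <;> nlinarith [sq_nonneg (w.re + ζ.re), sq_nonneg (w.im + ζ.im)]
  have h2 : 0 < (R + 1) * (r + 1) *
      ((w.re * w.re + w.im * w.im) - (ζ.re * ζ.re + ζ.im * ζ.im)) :=
    mul_pos (mul_pos (by linarith) (by linarith)) (by linarith)
  have h3 := mul_pos (sub_pos.2 hR) (add_pos_of_nonneg_of_pos h1 h2)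
  nlinarith

theorem norm_eval_growth {R r : ℝ} (hr : 1 ≤ r) (hR : r < R) {n : ℕ} (hn : 1 ≤ n) {f : ℂ[X]}
    (hf : f.natDegree = n) (hzero : ∀ w : ℂ, 1 < ‖w‖ → f.eval w ≠ 0) {w : ℂ} (hw : 1 < ‖w‖) :
    ((R + 1) / (1 + r)) ^ n * ‖f.eval (r * w)‖ < ‖f.eval (R * w)‖ := by
  obtain ⟨a, ζ, rfl⟩ := exists_eq_C_mul_prod_X_sub_C f hf
  have hroot (i) : ‖ζ i‖ ≤ 1 := by
    by_contra! h
    refine hzero _ h ?_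
    rw [eval_mul, eval_prod, Finset.prod_eq_zero (Finset.mem_univ i) (by simp), mul_zero]
  have ha : 0 < ‖a‖ := by
    rw [norm_pos_iff]
    rintro rfl
    exact hzero w hw (by simp)
  have : NeZero n := ⟨by omega⟩
  have hpos (i) : 0 < ‖(r : ℂ) * w - ζ i‖ := by
    rw [norm_pos_iff, sub_ne_zero]
    intro h
    have h1 := hroot i
    rw [← h, norm_mul, Complex.norm_real, Real.norm_eq_abs, abs_of_pos (by linarith)] at h1
    nlinarith
  have hprod : ∏ i, ((R + 1) / (1 + r) * ‖(r : ℂ) * w - ζ i‖) < ∏ i, ‖(R : ℂ) * w - ζ i‖ := by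
    refine Finset.prod_lt_prod_of_nonempty (fun i _ => ?_) (fun i _ => ?_) Finset.univ_nonempty
    · exact mul_pos (div_pos (by linarith) (by linarith)) (hpos i)
    · rw [div_mul_eq_mul_div, div_lt_iff₀ (by linarith), mul_comm _ (1 + r)]
      exact norm_sub_growth hr hR hw (hroot i)
  rw [Finset.prod_mul_distrib, Finset.prod_const, Finset.card_univ, Fintype.card_fin] at hprod
  simp only [eval_mul, eval_C, eval_prod, eval_sub, eval_X, norm_mul, norm_prod]
  nlinarith

theorem RahmanAdmissible.rahmanT_ne_zero {n : ℕ} {l₀ l₁ l₂ : ℂ}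
    (hB : RahmanAdmissible n l₀ l₁ l₂) (hn : 1 ≤ n) {R r : ℝ} (hr : 1 ≤ r) (hR : r < R) {Φ : ℂ}
    (hΦ : ‖Φ‖ ≤ ((R + 1) / (1 + r)) ^ n) {f : ℂ[X]} (hf : f.natDegree = n)
    (hzero : ∀ w : ℂ, 1 < ‖w‖ → f.eval w ≠ 0) {z : ℂ} (hz : 1 < ‖z‖) :
    rahmanT n l₀ l₁ l₂ R r Φ z f ≠ 0 := by
  rw [rahmanT_eq_eval]
  refine hB.eval_rahmanB_ne_zero hn (ρ := 1) ?_ (fun w hw => ?_) hz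
  · refine natDegree_eq_of_le_of_coeff_ne_zero ?_ ?_
    · refine natDegree_add_le_of_degree_le ?_ ((natDegree_C_mul_le _ _).trans ?_) <;>
        exact (natDegree_dilate_le _ _).trans hf.le
    · have hlead : f.coeff n ≠ 0 := by
        rw [← hf, coeff_natDegree, leadingCoeff_ne_zero]
        rintro rfl
        simp at hf
        omega
      -- The leading coefficient survives because `|Φ| r ^ n < R ^ n`, as `(R + 1) / (1 + r) * r <
      -- R`.
      rw [coeff_add, coeff_C_mul, coeff_dilate, coeff_dilate]
      intro h
      have h1 : (R : ℂ) ^ n = -(Φ * (r : ℂ) ^ n) := by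
        refine mul_left_cancel₀ hlead ?_
        linear_combination h
      have h2 : R ^ n = ‖Φ‖ * r ^ n := by
        have := congrArg norm h1
        rwa [norm_neg, norm_mul, norm_pow, norm_pow, Complex.norm_real, Complex.norm_real,
          Real.norm_eq_abs, Real.norm_eq_abs, abs_of_pos (by linarith),
          abs_of_pos (by linarith)] at this
      have h3 : ‖Φ‖ * r ^ n ≤ ((R + 1) / (1 + r) * r) ^ n := by
        rw [mul_pow]
        gcongr
      have h4 : (R + 1) / (1 + r) * r < R := by
        rw [div_mul_eq_mul_div, div_lt_iff₀ (by linarith)]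
        nlinarith
      have h5 : ((R + 1) / (1 + r) * r) ^ n < R ^ n :=
        pow_lt_pow_left₀ h4 (mul_nonneg (div_nonneg (by linarith) (by linarith)) (by linarith))
          (by omega)
      linarith
  · intro h
    rw [eval_add, eval_C_mul, eval_dilate, eval_dilate, add_eq_zero_iff_eq_neg] at h
    have h1 := norm_eval_growth hr hR hn hf hzero hw
    rw [h, norm_neg, norm_mul] at h1
    exact absurd h1 (not_lt.2 (by gcongr))

theorem eval_reflect_inv {P : ℂ[X]} {n : ℕ} (hP : P.natDegree ≤ n) {w : ℂ} (hw : w ≠ 0) :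
    (reflect n P).eval w⁻¹ * w ^ n = P.eval w := by
  let := invertibleOfNonzero hw
  simpa [eval₂_eq_eval_map] using eval₂_reflect_mul_pow (RingHom.id ℂ) w n P hP

theorem norm_coeff_le_of_norm_eval_le {P F : ℂ[X]} {n : ℕ} (hP : P.natDegree ≤ n)
    (hF : F.natDegree ≤ n) (h : ∀ w : ℂ, 1 < ‖w‖ → ‖P.eval w‖ ≤ ‖F.eval w‖) :
    ‖P.coeff n‖ ≤ ‖F.coeff n‖ := by
  have hev : ∀ᶠ u in nhdsWithin (0 : ℂ) {0}ᶜ,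
      ‖(reflect n P).eval u‖ ≤ ‖(reflect n F).eval u‖ := by
    have hb : Metric.ball (0 : ℂ) 1 ∈ nhdsWithin (0 : ℂ) {0}ᶜ :=
      mem_nhdsWithin_of_mem_nhds (Metric.ball_mem_nhds _ one_pos)
    filter_upwards [hb, self_mem_nhdsWithin] with u hu hu0
    have hu0 : u ≠ 0 := hu0
    have hu1 : 1 < ‖u⁻¹‖ := by
      rw [norm_inv]
      exact (one_lt_inv₀ (norm_pos_iff.2 hu0)).2 (by simpa using hu)
    have := h u⁻¹ hu1
    rw [← eval_reflect_inv hP (inv_ne_zero hu0), ← eval_reflect_inv hF (inv_ne_zero hu0), inv_inv,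
      norm_mul, norm_mul] at this
    exact le_of_mul_le_mul_right this (norm_pos_iff.2 (pow_ne_zero _ (inv_ne_zero hu0)))
  have hlim (G : ℂ[X]) : Filter.Tendsto (fun u => ‖(reflect n G).eval u‖)
      (nhdsWithin (0 : ℂ) {0}ᶜ) (nhds ‖G.coeff n‖) := by
    have h1 : (reflect n G).eval 0 = G.coeff n := by
      rw [← coeff_zero_eq_eval_zero, coeff_reflect, revAt_le (Nat.zero_le _), Nat.sub_zero]
    rw [← h1]
    exact ((reflect n G).continuous.norm.tendsto 0).mono_left nhdsWithin_le_nhds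
  exact le_of_tendsto_of_tendsto (hlim P) (hlim F) hev

/-- Were the inequality false, `μ = T F / T P` would have modulus below 1. Then `μ P - F` would
still have degree `n` and no zeros outside the disk, while `T` kills it at `z`, against
`rahmanT_ne_zero`. -/
theorem RahmanAdmissible.norm_rahmanT_le_of_one_lt {n : ℕ} {l₀ l₁ l₂ : ℂ}
    (hB : RahmanAdmissible n l₀ l₁ l₂) {R r : ℝ} (hr : 1 ≤ r) (hR : r < R) {Φ : ℂ}
    (hΦ : ‖Φ‖ ≤ ((R + 1) / (1 + r)) ^ n) {P F : ℂ[X]} (hP : P.natDegree ≤ n)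
    (hF : F.natDegree = n) (hzero : ∀ w : ℂ, 1 < ‖w‖ → F.eval w ≠ 0)
    (h : ∀ w : ℂ, 1 < ‖w‖ → ‖P.eval w‖ ≤ ‖F.eval w‖) {z : ℂ} (hz : 1 < ‖z‖) :
    ‖rahmanT n l₀ l₁ l₂ R r Φ z P‖ ≤ ‖rahmanT n l₀ l₁ l₂ R r Φ z F‖ := by
  rcases Nat.eq_zero_or_pos n with hn | hn
  -- For `n = 0` admissibility carries no information, but `T` only multiplies constants by `(1 + Φ)
  -- l₀`.
  · have h1 := h z hz
    rw [eq_C_of_natDegree_le_zero (hn ▸ hP : P.natDegree ≤ 0),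
      eq_C_of_natDegree_le_zero (hn ▸ hF.le : F.natDegree ≤ 0)] at h1 ⊢
    rw [eval_C, eval_C] at h1
    rw [rahmanT_C, rahmanT_C, norm_mul, norm_mul (F.coeff 0)]
    gcongr
  by_contra! hlt
  have hTP : rahmanT n l₀ l₁ l₂ R r Φ z P ≠ 0 :=
    norm_pos_iff.1 ((norm_nonneg _).trans_lt hlt)
  set μ := rahmanT n l₀ l₁ l₂ R r Φ z F / rahmanT n l₀ l₁ l₂ R r Φ z P with hμ
  have hμ1 : ‖μ‖ < 1 := by
    rw [hμ, norm_div]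
    exact (div_lt_one (norm_pos_iff.2 hTP)).2 hlt
  have hlead : F.coeff n ≠ 0 := by
    rw [← hF, coeff_natDegree, leadingCoeff_ne_zero]
    rintro rfl
    exact hzero z hz (by simp)
  have key {a b : ℂ} (hb : b ≠ 0) (hab : ‖a‖ ≤ ‖b‖) : μ * a - b ≠ 0 := by
    intro h0
    have h1 : ‖b‖ = ‖μ‖ * ‖a‖ := by rw [← norm_mul, sub_eq_zero.1 h0]
    have h2 := norm_pos_iff.2 hb
    nlinarith [norm_nonneg μ]
  refine hB.rahmanT_ne_zero hn hr hR hΦ (f := C μ * P - F) ?_ (fun w hw => ?_) hz ?_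
  · refine natDegree_eq_of_le_of_coeff_ne_zero ?_ ?_
    · exact natDegree_sub_le_of_le ((natDegree_C_mul_le _ _).trans hP) hF.le |>.trans (by simp)
    · rw [coeff_sub, coeff_C_mul]
      exact key hlead (norm_coeff_le_of_norm_eval_le hP hF.le h)
  · rw [eval_sub, eval_C_mul]
    exact key (hzero w hw) (h w hw)
  · rw [rahmanT_sub, rahmanT_C_mul, hμ, div_mul_cancel₀ _ hTP, sub_self]

theorem RahmanAdmissible.norm_rahmanT_le {n : ℕ} {l₀ l₁ l₂ : ℂ}
    (hB : RahmanAdmissible n l₀ l₁ l₂) {R r : ℝ} (hr : 1 ≤ r) (hR : r < R) {Φ : ℂ}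
    (hΦ : ‖Φ‖ ≤ ((R + 1) / (1 + r)) ^ n) {P F : ℂ[X]} (hP : P.natDegree ≤ n)
    (hF : F.natDegree = n) (hzero : ∀ w : ℂ, 1 < ‖w‖ → F.eval w ≠ 0)
    (h : ∀ w : ℂ, 1 < ‖w‖ → ‖P.eval w‖ ≤ ‖F.eval w‖) {z : ℂ} (hz : 1 ≤ ‖z‖) :
    ‖rahmanT n l₀ l₁ l₂ R r Φ z P‖ ≤ ‖rahmanT n l₀ l₁ l₂ R r Φ z F‖ := by
  have hlim (G : ℂ[X]) : Filter.Tendsto (fun t : ℝ => ‖rahmanT n l₀ l₁ l₂ R r Φ (t * z) G‖)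
      (nhdsWithin 1 (Set.Ioi 1)) (nhds ‖rahmanT n l₀ l₁ l₂ R r Φ z G‖) := by
    have hc : Continuous fun t : ℝ => ‖rahmanT n l₀ l₁ l₂ R r Φ (t * z) G‖ :=
      ((continuous_rahmanT n l₀ l₁ l₂ R r Φ G).comp
        (Complex.continuous_ofReal.mul continuous_const)).norm
    have := hc.tendsto 1
    rw [Complex.ofReal_one, one_mul] at this
    exact this.mono_left nhdsWithin_le_nhds
  refine le_of_tendsto_of_tendsto (hlim P) (hlim F) ?_
  filter_upwards [self_mem_nhdsWithin] with t ht
  have ht : 1 < t := ht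
  refine hB.norm_rahmanT_le_of_one_lt hr hR hΦ hP hF hzero h ?_
  rw [norm_mul, Complex.norm_real, Real.norm_eq_abs, abs_of_pos (by linarith)]
  nlinarith

/-! ### The conjugate reciprocal polynomial -/

/-- The polynomial `z ↦ zⁿ conj (P (1 / conj z))`. -/
noncomputable def conjReflect (n : ℕ) (P : ℂ[X]) : ℂ[X] := (reflect n P).map (starRingEnd ℂ)

theorem coeff_conjReflect_self (n : ℕ) (P : ℂ[X]) :
    (conjReflect n P).coeff n = (starRingEnd ℂ) (P.coeff 0) := by
  rw [conjReflect, coeff_map, coeff_reflect, revAt_le le_rfl, Nat.sub_self]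

theorem natDegree_conjReflect_le {n : ℕ} {P : ℂ[X]} (hP : P.natDegree ≤ n) :
    (conjReflect n P).natDegree ≤ n := by
  refine natDegree_map_le.trans (natDegree_le_iff_coeff_eq_zero.2 fun j hj => ?_)
  rw [coeff_reflect, revAt_eq_self_of_lt hj]
  exact coeff_eq_zero_of_natDegree_lt (hP.trans_lt hj)

theorem conjReflect_sub_C (n : ℕ) (P : ℂ[X]) (c : ℂ) :
    conjReflect n (P - C c) = conjReflect n P - C ((starRingEnd ℂ) c) * X ^ n := by
  simp [conjReflect, reflect_sub]

theorem norm_eval_conjReflect {n : ℕ} {P : ℂ[X]} (hP : P.natDegree ≤ n) {w : ℂ} (hw : w ≠ 0) :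
    ‖(conjReflect n P).eval w‖ = ‖w‖ ^ n * ‖P.eval ((starRingEnd ℂ) w)⁻¹‖ := by
  have hw' : (starRingEnd ℂ) w ≠ 0 := (_root_.map_ne_zero _).2 hw
  have h1 : (conjReflect n P).eval w
      = (starRingEnd ℂ) ((reflect n P).eval ((starRingEnd ℂ) w)) := by
    rw [conjReflect, ← eval₂_hom, ← eval_map]
    simp
  rw [h1, Complex.norm_conj, ← eval_reflect_inv hP (inv_ne_zero hw'), inv_inv, norm_mul, norm_pow,
    norm_inv, Complex.norm_conj]
  have : ‖w‖ ≠ 0 := norm_ne_zero_iff.2 hw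
  rw [mul_left_comm, ← mul_pow, mul_inv_cancel₀ this, one_pow, mul_one]

theorem norm_conj_inv_lt_one {w : ℂ} (hw : 1 < ‖w‖) : ‖((starRingEnd ℂ) w)⁻¹‖ < 1 := by
  rw [norm_inv, Complex.norm_conj]
  exact inv_lt_one_of_one_lt₀ hw

theorem eval_conjReflect_ne_zero {n : ℕ} {P : ℂ[X]} (hP : P.natDegree ≤ n)
    (hzero : ∀ w : ℂ, ‖w‖ < 1 → P.eval w ≠ 0) {w : ℂ} (hw : 1 < ‖w‖) :
    (conjReflect n P).eval w ≠ 0 := by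
  have hw0 : w ≠ 0 := norm_pos_iff.1 (by linarith)
  rw [← norm_ne_zero_iff, norm_eval_conjReflect hP hw0]
  exact mul_ne_zero (pow_ne_zero _ (norm_ne_zero_iff.2 hw0))
    (norm_ne_zero_iff.2 (hzero _ (norm_conj_inv_lt_one hw)))

theorem natDegree_conjReflect {n : ℕ} {P : ℂ[X]} (hP : P.natDegree ≤ n)
    (hzero : ∀ w : ℂ, ‖w‖ < 1 → P.eval w ≠ 0) : (conjReflect n P).natDegree = n := by
  refine natDegree_eq_of_le_of_coeff_ne_zero (natDegree_conjReflect_le hP) ?_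
  rw [coeff_conjReflect_self, _root_.map_ne_zero, coeff_zero_eq_eval_zero]
  exact hzero 0 (by simp)

/-- Equivalent to `|w - ζ| ≤ |1 - conj w * ζ|`, whose squares differ by `(|w| ^ 2 - 1) * (|ζ| ^ 2 -
1)`. -/
theorem norm_sub_le_mul_norm_conj_inv_sub {w ζ : ℂ} (hw : 1 < ‖w‖) (hζ : 1 ≤ ‖ζ‖) :
    ‖w - ζ‖ ≤ ‖w‖ * ‖((starRingEnd ℂ) w)⁻¹ - ζ‖ := by
  have hw0 : (starRingEnd ℂ) w ≠ 0 := (_root_.map_ne_zero _).2 (norm_pos_iff.1 (by linarith))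
  rw [← Complex.norm_conj w, ← norm_mul, mul_sub, mul_inv_cancel₀ hw0]
  refine le_of_sq_le_sq ?_ (norm_nonneg _)
  have hs : 1 ≤ ‖w‖ ^ 2 := one_le_pow₀ hw.le
  have ht : 1 ≤ ‖ζ‖ ^ 2 := one_le_pow₀ hζ
  simp only [Complex.sq_norm, Complex.normSq_apply, Complex.sub_re, Complex.sub_im, Complex.mul_re,
    Complex.mul_im, Complex.conj_re, Complex.conj_im, Complex.one_re, Complex.one_im] at hs ht ⊢
  nlinarith [mul_nonneg (sub_nonneg.2 hs) (sub_nonneg.2 ht)]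

theorem norm_eval_le_norm_eval_conjReflect {n : ℕ} {P : ℂ[X]} (hP : P.natDegree ≤ n)
    (hzero : ∀ w : ℂ, ‖w‖ < 1 → P.eval w ≠ 0) {w : ℂ} (hw : 1 < ‖w‖) :
    ‖P.eval w‖ ≤ ‖(conjReflect n P).eval w‖ := by
  rw [norm_eval_conjReflect hP (norm_pos_iff.1 (by linarith))]
  obtain ⟨m, hm⟩ : ∃ m, P.natDegree = m := ⟨_, rfl⟩
  rw [hm] at hP
  obtain ⟨a, ζ, rfl⟩ := exists_eq_C_mul_prod_X_sub_C P hm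
  have hroot (i) : 1 ≤ ‖ζ i‖ := by
    by_contra! h
    refine hzero _ h ?_
    rw [eval_mul, eval_prod, Finset.prod_eq_zero (Finset.mem_univ i) (by simp), mul_zero]
  simp only [eval_mul, eval_C, eval_prod, eval_sub, eval_X, norm_mul, norm_prod]
  have h1 : ∏ i, ‖w - ζ i‖ ≤ ‖w‖ ^ m * ∏ i, ‖((starRingEnd ℂ) w)⁻¹ - ζ i‖ := by
    have : ‖w‖ ^ m = ∏ _i : Fin m, ‖w‖ := by simp
    rw [this, ← Finset.prod_mul_distrib]
    exact Finset.prod_le_prod (fun i _ => norm_nonneg _)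
      fun i _ => norm_sub_le_mul_norm_conj_inv_sub hw (hroot i)
  -- The degree `m` of `P` may be below `n`; the reciprocal then gains the factor `|w| ^ (n - m) ≥
  -- 1`.
  have h2 : ‖w‖ ^ m ≤ ‖w‖ ^ n := pow_le_pow_right₀ hw.le hP
  calc ‖a‖ * ∏ i, ‖w - ζ i‖ ≤ ‖a‖ * (‖w‖ ^ n * ∏ i, ‖((starRingEnd ℂ) w)⁻¹ - ζ i‖) := by
        gcongr
        exact h1.trans (by gcongr)
    _ = _ := by ring

/-- The argument of `c` is chosen so that `conj c * b` points in the direction of `a`. -/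
theorem exists_norm_eq_norm_sub_conj_mul (a b : ℂ) {s : ℝ} (hs : 0 ≤ s) :
    ∃ c : ℂ, ‖c‖ = s ∧ ‖a - (starRingEnd ℂ) c * b‖ = |s * ‖b‖ - ‖a‖| := by
  have polar (x : ℂ) : ∃ u : ℂ, ‖u‖ = 1 ∧ x = ‖x‖ * u :=
    ⟨Complex.exp (x.arg * Complex.I), Complex.norm_exp_ofReal_mul_I _,
      (Complex.norm_mul_exp_arg_mul_I x).symm⟩
  obtain ⟨u, hu, hau⟩ := polar a
  obtain ⟨v, hv, hbv⟩ := polar b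
  have hv0 : v ≠ 0 := norm_pos_iff.1 (by rw [hv]; exact one_pos)
  refine ⟨(starRingEnd ℂ) (s * u / v), ?_, ?_⟩
  · rw [Complex.norm_conj, norm_div, norm_mul, hu, hv, Complex.norm_real, Real.norm_eq_abs,
      abs_of_nonneg hs, mul_one, div_one]
  · have : a - (starRingEnd ℂ) ((starRingEnd ℂ) (s * u / v)) * b
        = ((‖a‖ - s * ‖b‖ : ℝ) : ℂ) * u := by
      rw [Complex.conj_conj]
      conv_lhs => rw [hau, hbv]
      push_cast
      field_simp
    rw [this, norm_mul, hu, mul_one, Complex.norm_real, Real.norm_eq_abs, abs_sub_comm]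

/-! ### The estimate in the unit disk -/

/-- The comparison of a polynomial without zeros in the unit disk with constants and monomials. -/
theorem RahmanAdmissible.two_mul_norm_rahmanT_le {n : ℕ} {l₀ l₁ l₂ : ℂ}
    (hB : RahmanAdmissible n l₀ l₁ l₂) {R r : ℝ} (hr : 1 ≤ r) (hR : r < R) {Φ : ℂ}
    (hΦ : ‖Φ‖ ≤ ((R + 1) / (1 + r)) ^ n) {P : ℂ[X]} (hP : P.natDegree ≤ n)
    (hzero : ∀ w : ℂ, ‖w‖ < 1 → P.eval w ≠ 0) {m M : ℝ} (hm0 : 0 ≤ m)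
    (hm : ∀ w : ℂ, ‖w‖ < 1 → m ≤ ‖P.eval w‖) (hM : ∀ w : ℂ, ‖w‖ < 1 → ‖P.eval w‖ ≤ M)
    {z : ℂ} (hz : 1 ≤ ‖z‖) :
    2 * ‖rahmanT n l₀ l₁ l₂ R r Φ z P‖
      ≤ (‖rahmanT n l₀ l₁ l₂ R r Φ z (X ^ n)‖ + ‖(1 + Φ) * l₀‖) * M
        - (‖rahmanT n l₀ l₁ l₂ R r Φ z (X ^ n)‖ - ‖(1 + Φ) * l₀‖) * m := by
  set T := rahmanT n l₀ l₁ l₂ R r Φ z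
  set Q := conjReflect n P
  have hM0 : 0 < M := (norm_pos_iff.2 (hzero 0 (by simp))).trans_le (hM 0 (by simp))
  have hshift (c : ℂ) (hc : ∀ w : ℂ, ‖w‖ < 1 → P.eval w ≠ c) :
      ‖T P‖ - ‖c‖ * ‖(1 + Φ) * l₀‖ ≤ ‖T Q - (starRingEnd ℂ) c * T (X ^ n)‖ := by
    have hd : (P - C c).natDegree ≤ n := by rwa [natDegree_sub_C]
    have hc' : ∀ w : ℂ, ‖w‖ < 1 → (P - C c).eval w ≠ 0 := fun w hw => by
      rw [eval_sub, eval_C]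
      exact sub_ne_zero.2 (hc w hw)
    have := hB.norm_rahmanT_le hr hR hΦ hd (natDegree_conjReflect hd hc')
      (fun w hw => eval_conjReflect_ne_zero hd hc' hw)
      (fun w hw => norm_eval_le_norm_eval_conjReflect hd hc' hw) hz
    rw [conjReflect_sub_C, rahmanT_sub, rahmanT_sub, rahmanT_C_mul, rahmanT_C] at this
    refine le_trans ?_ this
    rw [← norm_mul]
    exact norm_sub_norm_le _ _
  have hQ {w : ℂ} (hw : 1 < ‖w‖) : ‖Q.eval w‖ = ‖w‖ ^ n * ‖P.eval ((starRingEnd ℂ) w)⁻¹‖ :=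
    norm_eval_conjReflect hP (norm_pos_iff.1 (by linarith))
  have hupper : ‖T Q‖ ≤ M * ‖T (X ^ n)‖ := by
    have hMC : (M : ℂ) ≠ 0 := by exact_mod_cast hM0.ne'
    have := hB.norm_rahmanT_le hr hR hΦ (P := Q) (F := C (M : ℂ) * X ^ n) (z := z)
      (natDegree_conjReflect_le hP) (natDegree_C_mul_X_pow n _ hMC)
      (fun w hw => by
        rw [eval_mul, eval_C, eval_pow, eval_X]
        exact mul_ne_zero hMC (pow_ne_zero _ (norm_pos_iff.1 (by linarith))))
      (fun w hw => by
        rw [hQ hw, eval_mul, eval_C, eval_pow, eval_X, norm_mul, norm_pow, Complex.norm_real,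
          Real.norm_eq_abs, abs_of_pos hM0, mul_comm]
        gcongr
        exact hM _ (norm_conj_inv_lt_one hw)) hz
    rwa [rahmanT_C_mul, norm_mul, Complex.norm_real, Real.norm_eq_abs, abs_of_pos hM0] at this
  have hlower : m * ‖T (X ^ n)‖ ≤ ‖T Q‖ := by
    have := hB.norm_rahmanT_le hr hR hΦ (P := C (m : ℂ) * X ^ n) (F := Q) (z := z)
      (natDegree_C_mul_X_pow_le _ _) (natDegree_conjReflect hP hzero)
      (fun w hw => eval_conjReflect_ne_zero hP hzero hw)
      (fun w hw => by
        rw [hQ hw, eval_mul, eval_C, eval_pow, eval_X, norm_mul, norm_pow, Complex.norm_real,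
          Real.norm_eq_abs, abs_of_nonneg hm0, mul_comm]
        gcongr
        exact hm _ (norm_conj_inv_lt_one hw)) hz
    rwa [rahmanT_C_mul, norm_mul, Complex.norm_real, Real.norm_eq_abs, abs_of_nonneg hm0] at this
  clear_value T Q
  -- Strictly `s > M` ensures that `P` omits `c`, and `hupper` gives the sign of `s * |T(X ^ n)| -
  -- |T Q|`.
  have h1 : ‖T P‖ + ‖T Q‖ ≤ (‖T (X ^ n)‖ + ‖(1 + Φ) * l₀‖) * M := by
    have hlim : Filter.Tendsto (fun s : ℝ => (‖T (X ^ n)‖ + ‖(1 + Φ) * l₀‖) * s)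
        (nhdsWithin M (Set.Ioi M)) (nhds ((‖T (X ^ n)‖ + ‖(1 + Φ) * l₀‖) * M)) :=
      ((continuous_const.mul continuous_id).tendsto M).mono_left nhdsWithin_le_nhds
    refine ge_of_tendsto hlim ?_
    filter_upwards [self_mem_nhdsWithin] with s hs
    have hs : M < s := hs
    obtain ⟨c, hc, hcs⟩ := exists_norm_eq_norm_sub_conj_mul (T Q) (T (X ^ n)) (hM0.trans hs).le
    have h2 := hshift c fun w hw h => by
      have := hM w hw
      rw [h, hc] at this
      linarith
    rw [hcs, hc, abs_of_nonneg] at h2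
    · linarith
    · nlinarith [norm_nonneg (T (X ^ n))]
  -- Now `|c| = t * m` with `t < 1`: `P` omits `c` even when `m = 0`, being zero-free, and `hlower`
  -- gives the opposite sign.
  have h2 : ‖T P‖ ≤ ‖T Q‖ - (‖T (X ^ n)‖ - ‖(1 + Φ) * l₀‖) * m := by
    have hlim : Filter.Tendsto
        (fun t : ℝ => ‖T Q‖ - (‖T (X ^ n)‖ - ‖(1 + Φ) * l₀‖) * (t * m))
        (nhdsWithin 1 (Set.Iio 1)) (nhds (‖T Q‖ - (‖T (X ^ n)‖ - ‖(1 + Φ) * l₀‖) * m)) := by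
      have hc : Continuous fun t : ℝ => ‖T Q‖ - (‖T (X ^ n)‖ - ‖(1 + Φ) * l₀‖) * (t * m) := by
        fun_prop
      have := hc.tendsto 1
      rw [one_mul] at this
      exact this.mono_left nhdsWithin_le_nhds
    refine ge_of_tendsto hlim ?_
    have hIoo : Set.Ioo (0 : ℝ) 1 ∈ nhdsWithin (1 : ℝ) (Set.Iio 1) :=
      Ioo_mem_nhdsLT one_pos
    filter_upwards [hIoo] with t ht
    obtain ⟨c, hc, hcs⟩ := exists_norm_eq_norm_sub_conj_mul (T Q) (T (X ^ n))
      (mul_nonneg ht.1.le hm0)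
    have h2 := hshift c fun w hw h => by
      have h3 := hm w hw
      have h4 := norm_pos_iff.2 (hzero w hw)
      rw [h, hc] at h3 h4
      have h5 := pos_of_mul_pos_right h4 ht.1.le
      nlinarith [ht.2]
    have h5 : t * m * ‖T (X ^ n)‖ ≤ m * ‖T (X ^ n)‖ := by
      have : t * m ≤ m := by nlinarith [ht.2]
      exact mul_le_mul_of_nonneg_right this (norm_nonneg _)
    rw [hcs, hc, abs_of_nonpos (by linarith)] at h2
    linarith
  linarith

/-! ### Extrema on the circle and rescaling to radius `k` -/

theorem norm_eval_le_maxModulus (P : ℂ[X]) {k : ℝ} {w : ℂ} (hw : ‖w‖ < k) :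
    ‖P.eval w‖ ≤ maxModulus P k := by
  have hk : 0 < k := (norm_nonneg w).trans_lt hw
  refine Complex.norm_le_of_forall_mem_frontier_norm_le (Metric.isBounded_ball (x := 0) (r := k))
    P.differentiable.diffContOnCl (fun u hu => ?_) (subset_closure (by simpa using hw))
  rw [frontier_ball _ hk.ne'] at hu
  exact (isGreatest_maxModulus P hk.le).2 ⟨u, hu, rfl⟩

theorem minModulus_nonneg (P : ℂ[X]) {k : ℝ} (hk : 0 ≤ k) : 0 ≤ minModulus P k := by
  obtain ⟨u, -, hu⟩ := (isLeast_minModulus P hk).1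
  rw [← hu]
  exact norm_nonneg _

/-- The maximum principle for `1 / P`, unless `P` vanishes on the circle, where the minimum is 0. -/
theorem minModulus_le_norm_eval (P : ℂ[X]) {k : ℝ} (hP : ∀ w : ℂ, ‖w‖ < k → P.eval w ≠ 0) {w : ℂ}
    (hw : ‖w‖ < k) : minModulus P k ≤ ‖P.eval w‖ := by
  have hk : 0 < k := (norm_nonneg w).trans_lt hw
  rcases (minModulus_nonneg P hk.le).eq_or_lt with h0 | hpos
  · rw [← h0]
    exact norm_nonneg _
  have hle {u : ℂ} (hu : u ∈ Metric.sphere (0 : ℂ) k) : minModulus P k ≤ ‖P.eval u‖ :=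
    (isLeast_minModulus P hk.le).2 ⟨u, hu, rfl⟩
  have hne : ∀ u ∈ closure (Metric.ball (0 : ℂ) k), P.eval u ≠ 0 := by
    intro u hu
    rw [closure_ball _ hk.ne', mem_closedBall_zero_iff] at hu
    rcases hu.lt_or_eq with h | h
    · exact hP u h
    · exact norm_pos_iff.1 (hpos.trans_le (hle (by simpa using h)))
  have := Complex.norm_le_of_forall_mem_frontier_norm_le
    (Metric.isBounded_ball (x := (0 : ℂ)) (r := k)) (P.differentiable.diffContOnCl.inv hne)
    (C := (minModulus P k)⁻¹)
    (fun u hu => by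
      rw [frontier_ball _ hk.ne'] at hu
      rw [Pi.inv_apply, norm_inv]
      exact inv_anti₀ hpos (hle hu))
    (subset_closure (by simpa using hw : w ∈ Metric.ball (0 : ℂ) k))
  rw [Pi.inv_apply, norm_inv] at this
  exact (inv_le_inv₀ (norm_pos_iff.2 (hP w hw)) hpos).1 this

theorem dilate_dilate (s t : ℝ) (P : ℂ[X]) : dilate s (dilate t P) = dilate (t * s) P := by
  ext j
  rw [coeff_dilate, coeff_dilate, coeff_dilate]
  push_cast
  ring

theorem norm_rahmanPhi_le {n : ℕ} {k R r : ℝ} {α β : ℂ} (hα : ‖α‖ ≤ 1) (hβ : ‖β‖ ≤ 1)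
    (hk : 0 < k) (hr : k ≤ r) (hR : r < R) :
    ‖rahmanPhi n k R r α β‖ ≤ ((R + k) / (k + r)) ^ n := by
  have h1 : 1 ≤ ((R + k) / (k + r)) ^ n :=
    one_le_pow₀ ((one_le_div (by linarith)).2 (by linarith))
  calc ‖rahmanPhi n k R r α β‖ ≤ ‖β‖ * |((R + k) / (k + r)) ^ n - ‖α‖| + ‖α‖ := by
        refine (norm_sub_le _ _).trans (le_of_eq ?_)
        rw [norm_mul, Complex.norm_real, Real.norm_eq_abs]
    _ ≤ 1 * (((R + k) / (k + r)) ^ n - ‖α‖) + ‖α‖ := by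
        rw [abs_of_nonneg (by linarith)]
        gcongr
        linarith
    _ = _ := by ring

theorem theorem2p7 (n : ℕ) (l₀ l₁ l₂ : ℂ) (hB : RahmanAdmissible n l₀ l₁ l₂)
    (P : ℂ[X]) (hdeg : P.natDegree ≤ n) (k : ℝ) (hk0 : 0 < k) (hk1 : k ≤ 1)
    (hP : ∀ w : ℂ, ‖w‖ < k → P.eval w ≠ 0)
    (α β : ℂ) (hα : ‖α‖ ≤ 1) (hβ : ‖β‖ ≤ 1)
    (R r : ℝ) (hr : k ≤ r) (hR : r < R) (z : ℂ) (hz : ‖z‖ = 1) :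
    ‖(rahmanB n l₀ l₁ l₂ (dilate R P)).eval z
        + rahmanPhi n k R r α β * (rahmanB n l₀ l₁ l₂ (dilate r P)).eval z‖
      ≤ 1 / 2 *
        ((‖(rahmanB n l₀ l₁ l₂ (X ^ n)).eval z‖ / k ^ n
              * ‖(R : ℂ) ^ n + (r : ℂ) ^ n * rahmanPhi n k R r α β‖
            + ‖1 + rahmanPhi n k R r α β‖ * ‖l₀‖) * maxModulus P k
          - (‖(rahmanB n l₀ l₁ l₂ (X ^ n)).eval z‖ / k ^ n
              * ‖(R : ℂ) ^ n + (r : ℂ) ^ n * rahmanPhi n k R r α β‖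
            - ‖1 + rahmanPhi n k R r α β‖ * ‖l₀‖) * minModulus P k) := by
  set Φ := rahmanPhi n k R r α β with hΦdef
  -- The quotient `(R + k) / (k + r)` is homogeneous, so `Φ` is unchanged by the rescaling.
  have hΦ : ‖Φ‖ ≤ ((R / k + 1) / (1 + r / k)) ^ n := by
    refine (norm_rahmanPhi_le hα hβ hk0 hr hR).trans (le_of_eq ?_)
    congr 1
    field_simp
  have hkw {w : ℂ} (hw : ‖w‖ < 1) : ‖(k : ℂ) * w‖ < k := by
    rw [norm_mul, Complex.norm_real, Real.norm_eq_abs, abs_of_pos hk0]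
    nlinarith
  have h := hB.two_mul_norm_rahmanT_le ((one_le_div hk0).2 hr) (div_lt_div_of_pos_right hR hk0) hΦ
    ((natDegree_dilate_le k P).trans hdeg)
    (fun w hw => by rw [eval_dilate]; exact hP _ (hkw hw)) (minModulus_nonneg P hk0.le)
    (fun w hw => by rw [eval_dilate]; exact minModulus_le_norm_eval P hP (hkw hw))
    (fun w hw => by rw [eval_dilate]; exact norm_eval_le_maxModulus P (hkw hw)) hz.ge
  have hA : ‖rahmanT n l₀ l₁ l₂ (R / k) (r / k) Φ z (X ^ n)‖
      = ‖(rahmanB n l₀ l₁ l₂ (X ^ n)).eval z‖ / k ^ n * ‖(R : ℂ) ^ n + (r : ℂ) ^ n * Φ‖ := by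
    have e : ((R / k : ℝ) : ℂ) ^ n + ((r / k : ℝ) : ℂ) ^ n * Φ
        = ((R : ℂ) ^ n + (r : ℂ) ^ n * Φ) / ((k ^ n : ℝ) : ℂ) := by
      push_cast
      rw [div_pow, div_pow]
      ring
    rw [rahmanT_X_pow, norm_mul, e, norm_div, Complex.norm_real, Real.norm_eq_abs,
      abs_of_pos (pow_pos hk0 n)]
    ring
  rw [hA, rahmanT, dilate_dilate, dilate_dilate, mul_div_cancel₀ _ hk0.ne',
    mul_div_cancel₀ _ hk0.ne', norm_mul (1 + Φ)] at h
  linarith
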